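/- Let $p=(p_1,\dots,p_n)$ be a system of $n$ complex polynomials in $n$ variables (for example an unmixed sparse system, i.e. one whose members all have the same support), and let $\xi\in(\mathbb C^\times)^n$ be a point at which the Jacobian $D_\xi(p)$ is invertible (for example a simple root of $p$ with no zero coordinate). Let $\|\cdot\|$ be any unitarily invariant norm on $\mathbb C^{n\times n}$, and define the local condition number by $\mu(f,\zeta)=\|f\|_W\,\|D_\zeta(f)^\dagger\|$, where $\dagger$ is the Moore–Penrose inverse and $\|f\|_W^2=\sum_i\sum_\alpha \frac{\alpha_1!\cdots\alpha_n!}{|\alpha|!}\,|f_{i,\alpha}|^2$ is the squared Bombieri–Weyl norm of $f_i=\sum_\alpha f_{i,\alpha}x^\alpha$. For $t\in\mathbb R_{>0}^n$ put $(t\cdot p)(x)=p(t_1^{-1}x_1,\dots,t_n^{-1}x_n)$, $t\cdot\xi=(t_1\xi_1,\dots,t_n\xi_n)$ and $t^{-1}=(t_1^{-1},\dots,t_n^{-1})$; for an $n\times n$ matrix $X$ put $(X\circ f)_i=\sum_j X_{ij}f_j$. Let $$h_\xi(t)=\log\sum_{i=1}^n|\xi|^{\omega_i}t^{-\omega_i},\qquad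 \omega_i=n e_i-(1,\dots,1),\qquad |\xi|^{\omega_i}=\prod_j|\xi_j|^{\omega_{ij}},\quad t^{-\omega_i}=\prod_j t_j^{-\omega_{ij}} .$$ Let $\mathrm{PD}(n)$ be the set of Hermitian positive definite complex $n\times n$ matrices. Identify $\mathrm{PD}(n)\times\mathbb R_{>0}^n$ with the space $K\backslash G$ of right cosets of $K=\mathrm U(n)\times(S^1)^n$ in $G=\mathrm{GL}_n(\mathbb C)\times(\mathbb C^\times)^n$ via $K(g,\tau)\mapsto\big((g^*g)^{1/2},|\tau|\big)$. A function $F$ on it is called geodesically convex if $s\mapsto F\big(K(e^{sH}g,e^{sv}\tau)\big)$ is convex on $\mathbb R$ for all $(g,\tau)\in G$, all Hermitian $H$ and all $v\in\mathbb R^n$. Then the functions $$(X,t)\mapsto \mu\big(X\circ(t^{-1}\cdot p),\,t^{-1}\cdot\xi\big)+h_\xi(t),\qquad (X,t)\mapsto \mu\big(X\circ(t\cdot p),\,t\cdot\xi\big)+h_\xi(t),\qquad (X,t)\mapsto h_\xi(t)$$ on $\mathrm{PD}(n)\times\mathbb R_{>0}^n$ are geodesically convex. Moreover, $t\in\mathbb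 R_{>0}^n$ minimizes $h_\xi$ over $\mathbb R_{>0}^n$ if and only if $|\xi_i|\,t_i^{-1}=|\xi_j|\,t_j^{-1}$ for all $i,j$. -/

import Mathlib

open scoped Matrix MatrixOrder ComplexOrder Nat ComplexConjugate

noncomputable section

namespace Precond

/-! Polynomial systems, the Bombieri-Weyl norm and the two group actions. -/

/-- The Bombieri-Weyl inner product on complex polynomials: distinct monomials are orthogonal and
`⟨x^α, x^α⟩ = α₁! ⋯ αₙ! / |α|!`. -/
def bwInner {σ : Type*} (f g : MvPolynomial σ ℂ) : ℂ :=
  ∑ α ∈ f.support,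
    (((α.prod fun _ k => (k ! : ℝ)) / (α.degree ! : ℝ) : ℝ) : ℂ) * (f.coeff α * conj (g.coeff α))

/-- The Bombieri-Weyl norm of a system of polynomials. -/
def bwNorm {σ ι : Type*} [Fintype ι] (f : ι → MvPolynomial σ ℂ) : ℝ :=
  Real.sqrt (∑ i, (bwInner (f i) (f i)).re)

/-- The shuffling action `X ∘ f = (∑ⱼ X₁ⱼ fⱼ, …, ∑ⱼ Xₘⱼ fⱼ)`. -/
def shuffle {σ ι : Type*} [Fintype ι] (X : Matrix ι ι ℂ) (f : ι → MvPolynomial σ ℂ) :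
    ι → MvPolynomial σ ℂ :=
  fun i => ∑ j, X i j • f j

/-- The scaling action of `t` on a polynomial, `(t · p)(x) = p(t₁⁻¹ x₁, …, tₙ⁻¹ xₙ)`. -/
def scalePoly {σ : Type*} (t : σ → ℝ) (p : MvPolynomial σ ℂ) : MvPolynomial σ ℂ :=
  MvPolynomial.bind₁ (fun j => MvPolynomial.C (((t j)⁻¹ : ℝ) : ℂ) * MvPolynomial.X j) p

/-- The scaling action of `t` on a system of polynomials. -/
def scaleSystem {σ ι : Type*} (t : σ → ℝ) (f : ι → MvPolynomial σ ℂ) : ι → MvPolynomial σ ℂ :=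
  fun i => scalePoly t (f i)

/-- The scaling action of `t` on a point, `t · ξ = (t₁ ξ₁, …, tₙ ξₙ)`. -/
def scalePoint {σ : Type*} (t : σ → ℝ) (ξ : σ → ℂ) : σ → ℂ := fun j => (t j : ℂ) * ξ j

/-- The Jacobian matrix of the system `f` at `ξ`. -/
def jacobian {σ ι : Type*} (f : ι → MvPolynomial σ ℂ) (ξ : σ → ℂ) : Matrix ι σ ℂ :=
  Matrix.of fun i j => MvPolynomial.eval ξ (MvPolynomial.pderiv j (f i))

/-! The Moore-Penrose inverse and the local condition number. -/

/-- `B` is a Moore-Penrose inverse of `A`. -/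
structure IsMoorePenrose {m n : Type*} [Fintype m] [Fintype n]
    (A : Matrix m n ℂ) (B : Matrix n m ℂ) : Prop where
  mul_mul_left : A * B * A = A
  mul_mul_right : B * A * B = B
  isHermitian_left : (A * B).IsHermitian
  isHermitian_right : (B * A).IsHermitian

theorem exists_isMoorePenrose {m n : Type*} [Fintype m] [Fintype n]
    (A : Matrix m n ℂ) : ∃ B, IsMoorePenrose A B := by
  classical
  set M := Aᴴ * A with hM
  have hMh : Mᴴ = M := Matrix.isHermitian_conjTranspose_mul_self A
  have hsa : IsSelfAdjoint M := hMh
  have hid : cfc (fun x : ℝ => x) M = M := cfc_id' ℝ M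
  have hc : ∀ f : ℝ → ℝ, ContinuousOn f (spectrum ℝ M) := fun f =>
    (Matrix.finite_real_spectrum (A := M)).continuousOn f
  have hmul : ∀ f g : ℝ → ℝ, cfc f M * cfc g M = cfc (fun x => f x * g x) M := fun f g =>
    (cfc_mul f g M (hc _) (hc _)).symm
  obtain ⟨P, hPh, hPM, hMP, hMPM, hPMP⟩ : ∃ P : Matrix n n ℂ, Pᴴ = P ∧ (P * M)ᴴ = P * M ∧
      (M * P)ᴴ = M * P ∧ M * P * M = M ∧ P * M * P = P := by
    have hs : ∀ f : ℝ → ℝ, (cfc f M)ᴴ = cfc f M := fun f =>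
      (cfc_predicate f M : IsSelfAdjoint (cfc f M))
    have h1 : cfc (fun x : ℝ => x⁻¹) M * M = cfc (fun x : ℝ => x⁻¹ * x) M := by
      have := hmul (fun x => x⁻¹) (fun x => x)
      rwa [hid] at this
    have h2 : M * cfc (fun x : ℝ => x⁻¹) M = cfc (fun x : ℝ => x * x⁻¹) M := by
      have := hmul (fun x => x) (fun x => x⁻¹)
      rwa [hid] at this
    refine ⟨cfc (fun x : ℝ => x⁻¹) M, hs _, ?_, ?_, ?_, ?_⟩
    · rw [h1, hs]
    · rw [h2, hs]
    · have := hmul (fun x => x * x⁻¹) (fun x => x)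
      rw [hid] at this
      rw [h2, this]
      simpa only [mul_inv_mul_cancel] using hid
    · rw [h1, hmul]
      congr 1
      ext x
      simpa using mul_inv_mul_cancel x⁻¹
  have hAPM : A * P * M = A := by
    have h : (A * P * M - A)ᴴ * (A * P * M - A) = 0 := by
      have e : (A * P * M - A)ᴴ = M * P * Aᴴ - Aᴴ := by
        simp only [Matrix.conjTranspose_sub, Matrix.conjTranspose_mul, hPh, hMh, Matrix.mul_assoc]
      have e1 : Aᴴ * (A * P * M - A) = 0 := by
        rw [Matrix.mul_sub, Matrix.mul_assoc A, ← Matrix.mul_assoc Aᴴ, ← hM, ← Matrix.mul_assoc,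
          hMPM, sub_self]
      rw [e, Matrix.sub_mul, Matrix.mul_assoc, e1, Matrix.mul_zero, sub_zero]
    exact sub_eq_zero.mp (Matrix.conjTranspose_mul_self_eq_zero.mp h)
  refine ⟨P * Aᴴ, ?_, ?_, ?_, ?_⟩
  · rw [← Matrix.mul_assoc, Matrix.mul_assoc, ← hM, hAPM]
  · rw [Matrix.mul_assoc P, ← hM, ← Matrix.mul_assoc, hPMP]
  · simp only [Matrix.IsHermitian, Matrix.conjTranspose_mul, Matrix.conjTranspose_conjTranspose,
      hPh, Matrix.mul_assoc]
  · rw [Matrix.mul_assoc, ← hM]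
    exact hPM

/-- The Moore-Penrose inverse is unique. -/
theorem IsMoorePenrose.unique {m n : Type*} [Fintype m] [Fintype n]
    {A : Matrix m n ℂ} {B C : Matrix n m ℂ} (hB : IsMoorePenrose A B) (hC : IsMoorePenrose A C) :
    B = C := by
  have h1 : A * B = A * C := by
    have e1 : (A * C) * (A * B) = A * B := by
      rw [← Matrix.mul_assoc, hC.mul_mul_left]
    have e2 : (A * B) * (A * C) = A * C := by
      rw [← Matrix.mul_assoc, hB.mul_mul_left]
    calc A * B = (A * B)ᴴ := hB.isHermitian_left.symm
      _ = ((A * C) * (A * B))ᴴ := by rw [e1]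
      _ = (A * B) * (A * C) := by
        rw [Matrix.conjTranspose_mul, hB.isHermitian_left, hC.isHermitian_left]
      _ = A * C := e2
  have h2 : B * A = C * A := by
    have e1 : (B * A) * (C * A) = B * A := by
      rw [Matrix.mul_assoc, ← Matrix.mul_assoc A, hC.mul_mul_left]
    have e2 : (C * A) * (B * A) = C * A := by
      rw [Matrix.mul_assoc, ← Matrix.mul_assoc A, hB.mul_mul_left]
    calc B * A = (B * A)ᴴ := hB.isHermitian_right.symm
      _ = ((B * A) * (C * A))ᴴ := by rw [e1]
      _ = (C * A) * (B * A) := by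
        rw [Matrix.conjTranspose_mul, hB.isHermitian_right, hC.isHermitian_right]
      _ = C * A := e2
  calc B = B * A * B := hB.mul_mul_right.symm
    _ = C * A * B := by rw [h2]
    _ = C * (A * B) := Matrix.mul_assoc _ _ _
    _ = C * (A * C) := by rw [h1]
    _ = C * A * C := (Matrix.mul_assoc _ _ _).symm
    _ = C := hC.mul_mul_right

/-- The Moore-Penrose inverse `A†`. -/
def pinv {m n : Type*} [Fintype m] [Fintype n] (A : Matrix m n ℂ) : Matrix n m ℂ :=
  Classical.choose (exists_isMoorePenrose A)

/-- `N` is a norm on complex matrices that is invariant under unitary matrices on both sides. -/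
structure IsUnitarilyInvariantNorm {m n : Type*} [Fintype m] [Fintype n] [DecidableEq m]
    [DecidableEq n] (N : Seminorm ℂ (Matrix m n ℂ)) : Prop where
  eq_zero : ∀ A, N A = 0 → A = 0
  unitary_mul_mul : ∀ U ∈ Matrix.unitaryGroup m ℂ, ∀ V ∈ Matrix.unitaryGroup n ℂ, ∀ A,
    N (U * A * V) = N A

/-- The local condition number `μ(f, ξ) = ‖f‖_W ‖D_ξ(f)†‖` with respect to the norm `N`. -/
def localCond {σ ι : Type*} [Fintype σ] [Fintype ι] (N : Seminorm ℂ (Matrix σ ι ℂ))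
    (f : ι → MvPolynomial σ ℂ) (ξ : σ → ℂ) : ℝ :=
  bwNorm f * N (pinv (jacobian f ξ))

/-! The function `h_ξ`. -/

/-- The exponent vectors `ω_i = n e_i - (1, …, 1)`. -/
def omega (n : ℕ) (i j : Fin n) : ℤ := (n : ℤ) * (Pi.single i 1 : Fin n → ℤ) j - 1

/-- `h_ξ(t) = log (∑ᵢ |ξ|^{ω_i} t^{-ω_i})`. -/
def hFun {n : ℕ} (ξ : Fin n → ℂ) (t : Fin n → ℝ) : ℝ :=
  Real.log (∑ i, (∏ j, ‖ξ j‖ ^ omega n i j) * (∏ j, t j ^ (-omega n i j)))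

/-! The manifold `PD(n) × ℝ_{>0}^n` as the space of right cosets `K \ G` of
`K = U(n) × (S¹)^n` in `G = GL_n(ℂ) × (ℂˣ)^n`, and its geodesics. -/

/-- Hermitian positive definite complex matrices. -/
abbrev PD (n : ℕ) : Type := {X : Matrix (Fin n) (Fin n) ℂ // X.PosDef}

/-- Vectors with positive real entries. -/
abbrev PosVec (n : ℕ) : Type := {t : Fin n → ℝ // ∀ i, 0 < t i}

/-- The group `GL_n(ℂ) × (ℂˣ)^n`. -/
abbrev PreGroup (n : ℕ) : Type := GL (Fin n) ℂ × (Fin n → ℂˣ)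

/-- The maximal compact subgroup `U(n) × (S¹)^n`, as a set. -/
def maxCompact (n : ℕ) : Set (PreGroup n) :=
  {k | (k.1 : Matrix (Fin n) (Fin n) ℂ) ∈ Matrix.unitaryGroup (Fin n) ℂ ∧ ∀ i, ‖(k.2 i : ℂ)‖ = 1}

theorem posDef_gram {n : ℕ} (g : GL (Fin n) ℂ) :
    ((g : Matrix (Fin n) (Fin n) ℂ)ᴴ * (g : Matrix (Fin n) (Fin n) ℂ)).PosDef :=
  (Matrix.posSemidef_conjTranspose_mul_self _).posDef_iff_isUnit.mpr
    ((g.isUnit.star).mul g.isUnit)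

theorem posDef_sqrt_gram {n : ℕ} (g : GL (Fin n) ℂ) :
    (CFC.sqrt ((g : Matrix (Fin n) (Fin n) ℂ)ᴴ * (g : Matrix (Fin n) (Fin n) ℂ))).PosDef :=
  Matrix.isStrictlyPositive_iff_posDef.mp (posDef_gram g).isStrictlyPositive.sqrt

/-- The representative of the coset `K (g, τ)` in `PD(n) × ℝ_{>0}^n`, namely
`((g* g)^{1/2}, |τ|)`, the positive part of the polar decomposition. -/
def cosetRep {n : ℕ} (g : PreGroup n) : PD n × PosVec n :=
  (⟨CFC.sqrt ((g.1 : Matrix (Fin n) (Fin n) ℂ)ᴴ * (g.1 : Matrix (Fin n) (Fin n) ℂ)),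
      posDef_sqrt_gram g.1⟩,
    ⟨fun i => ‖(g.2 i : ℂ)‖, fun i => norm_pos_iff.mpr (g.2 i).ne_zero⟩)

/-- The fibres of `cosetRep` are exactly the right cosets `K g`. -/
theorem cosetRep_eq_iff {n : ℕ} (g g' : PreGroup n) :
    cosetRep g = cosetRep g' ↔ ∃ k ∈ maxCompact n, g' = k * g := by
  constructor
  · intro h
    have h1 := congrArg (fun q => q.1.1) h
    have h2 : ∀ i, ‖(g.2 i : ℂ)‖ = ‖(g'.2 i : ℂ)‖ := fun i => congrArg (fun q => q.2.1 i) h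
    simp only [cosetRep] at h1
    have h3 : (g.1 : Matrix (Fin n) (Fin n) ℂ)ᴴ * g.1 = (g'.1 : Matrix (Fin n) (Fin n) ℂ)ᴴ * g'.1 := by
      rw [← CFC.sqrt_mul_sqrt_self _ (posDef_gram g.1).posSemidef.nonneg, h1,
        CFC.sqrt_mul_sqrt_self _ (posDef_gram g'.1).posSemidef.nonneg]
    refine ⟨g' * g⁻¹, ⟨?_, fun i => ?_⟩, by simp⟩
    · rw [Matrix.mem_unitaryGroup_iff']
      have e : (g.1 : Matrix (Fin n) (Fin n) ℂ) * ((g.1⁻¹ : GL (Fin n) ℂ) : Matrix _ _ ℂ) = 1 :=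
        Units.mul_inv g.1
      have e' : ((g.1⁻¹ : GL (Fin n) ℂ) : Matrix _ _ ℂ)ᴴ * (g.1 : Matrix (Fin n) (Fin n) ℂ)ᴴ = 1 := by
        rw [← Matrix.conjTranspose_mul, e, Matrix.conjTranspose_one]
      simp only [Prod.fst_mul, Prod.fst_inv, Units.val_mul, Matrix.star_eq_conjTranspose,
        Matrix.conjTranspose_mul]
      rw [Matrix.mul_assoc, ← Matrix.mul_assoc _ (g'.1 : Matrix (Fin n) (Fin n) ℂ), ← h3,
        Matrix.mul_assoc, e, Matrix.mul_one, e']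
    · simp [h2 i]
  · rintro ⟨k, ⟨hk1, hk2⟩, rfl⟩
    rw [Matrix.mem_unitaryGroup_iff', Matrix.star_eq_conjTranspose] at hk1
    refine Prod.ext (Subtype.ext ?_) (Subtype.ext (funext fun i => ?_))
    · simp only [cosetRep, Prod.fst_mul, Units.val_mul, Matrix.conjTranspose_mul]
      rw [Matrix.mul_assoc _ _ ((k.1 : Matrix (Fin n) (Fin n) ℂ) * _),
        ← Matrix.mul_assoc _ (k.1 : Matrix (Fin n) (Fin n) ℂ), hk1, Matrix.one_mul]
    · simp [cosetRep, hk2 i]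

/-- A point of `PD(n) × ℝ_{>0}^n`, as a group element, represents its own coset. -/
theorem cosetRep_self {n : ℕ} (q : PD n × PosVec n) (g : PreGroup n)
    (h1 : (g.1 : Matrix (Fin n) (Fin n) ℂ) = q.1.1) (h2 : ∀ i, (g.2 i : ℂ) = (q.2.1 i : ℂ)) :
    cosetRep g = q := by
  refine Prod.ext (Subtype.ext ?_) (Subtype.ext (funext fun i => ?_))
  · have h : (q.1.1)ᴴ = q.1.1 := q.1.2.isHermitian
    simp only [cosetRep, h1, h]
    exact CFC.sqrt_mul_self _ q.1.2.posSemidef.nonneg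
  · simp [cosetRep, h2 i, abs_of_pos (q.2.2 i)]

/-- The group element `(e^H, e^v)`. -/
def expPair {n : ℕ} (H : Matrix (Fin n) (Fin n) ℂ) (v : Fin n → ℝ) : PreGroup n :=
  ((Matrix.isUnit_exp H).unit, fun i => Units.mk0 (Real.exp (v i) : ℂ) (by
    exact_mod_cast (Real.exp_pos (v i)).ne'))

/-- `F` is geodesically convex on `PD(n) × ℝ_{>0}^n ≅ K \ G`: it is convex along every geodesic
`s ↦ K e^{sH} g`, where `g ∈ G` and `H ∈ i Lie(K) = Herm(n) × ℝ^n`. -/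
def GeodesicallyConvex {n : ℕ} (F : PD n × PosVec n → ℝ) : Prop :=
  ∀ (g : PreGroup n) (H : Matrix (Fin n) (Fin n) ℂ) (v : Fin n → ℝ), H.IsHermitian →
    ConvexOn ℝ Set.univ (fun s : ℝ => F (cosetRep (expPair (s • H) (s • v) * g)))

end Precond

end

noncomputable section

namespace Precond

/-! Along a geodesic, both factors of the condition number are log-convex in `s`. Hence so is their
product, which is therefore convex, and adding the convex function `h_ξ` keeps it convex.

The representative `(g* e^{2sH} g)^{1/2}` is awkward as a function of `s`, but both factors are
unchanged when it is multiplied on the left by a unitary matrix, so only its Gram matrix matters. If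
`e^{sH} = V D_s V*`, that Gram matrix is also the one of `D_s A` with `A = V* g`
(`exists_cosetRep_expPair_fst`), so all dependence on `s` sits in diagonal matrices of real
exponentials.

The squared Bombieri-Weyl norm then becomes a nonnegative combination of exponentials `e^{sλ}`
(`logConvex_bwNorm`). The inverse Jacobian becomes, up to a unitary factor, a fixed matrix between
two diagonal exponentials. Replacing `s` by `s + iy` multiplies these by unitary diagonal matrices,
so the norm depends on the real part only, and Hadamard's three lines theorem gives log-convexity
(`IsUnitarilyInvariantNorm.logConvex`).

Finally `h_ξ` is the logarithm of a positive combination of exponentials, hence convex. With `r_i =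
|ξ_i| / t_i` it equals `log (∑ r_i^n / ∏ r_j)`, so its minimizers are the equality case of AM-GM. -/

/-- A nonnegative function on the line whose logarithm is convex, zeros being allowed. -/
structure LogConvex (f : ℝ → ℝ) : Prop where
  nonneg : ∀ s, 0 ≤ f s
  le_rpow_mul_rpow : ∀ x y a b : ℝ, 0 ≤ a → 0 ≤ b → a + b = 1 →
    f (a * x + b * y) ≤ f x ^ a * f y ^ b

/-! ### Calculus of log-convex functions and the three lines theorem. -/

namespace LogConvex

theorem mul {f g : ℝ → ℝ} (hf : LogConvex f) (hg : LogConvex g) :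
    LogConvex (fun s => f s * g s) := by
  refine ⟨fun s => mul_nonneg (hf.nonneg s) (hg.nonneg s), fun x y a b ha hb hab => ?_⟩
  calc f (a * x + b * y) * g (a * x + b * y)
      ≤ (f x ^ a * f y ^ b) * (g x ^ a * g y ^ b) :=
        mul_le_mul (hf.2 x y a b ha hb hab) (hg.2 x y a b ha hb hab) (hg.nonneg _)
          (mul_nonneg (Real.rpow_nonneg (hf.nonneg _) _) (Real.rpow_nonneg (hf.nonneg _) _))
    _ = _ := by
        rw [Real.mul_rpow (hf.nonneg _) (hg.nonneg _), Real.mul_rpow (hf.nonneg _) (hg.nonneg _)]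
        ring

theorem sqrt {f : ℝ → ℝ} (hf : LogConvex f) : LogConvex (fun s => Real.sqrt (f s)) := by
  refine ⟨fun s => Real.sqrt_nonneg _, fun x y a b ha hb hab => ?_⟩
  have h := Real.sqrt_le_sqrt (hf.2 x y a b ha hb hab)
  refine h.trans_eq ?_
  rw [Real.sqrt_mul (Real.rpow_nonneg (hf.nonneg _) _)]
  simp only [Real.sqrt_eq_rpow]
  rw [← Real.rpow_mul (hf.nonneg _), ← Real.rpow_mul (hf.nonneg _), ← Real.rpow_mul (hf.nonneg _),
    ← Real.rpow_mul (hf.nonneg _), mul_comm a, mul_comm b]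

/-- Hölder's inequality with exponents `1/a` and `1/b`; these require `a, b > 0`, so the endpoints
are treated apart. -/
theorem sum {ι : Type*} (S : Finset ι) {f : ι → ℝ → ℝ} (hf : ∀ i ∈ S, LogConvex (f i)) :
    LogConvex (fun s => ∑ i ∈ S, f i s) := by
  refine ⟨fun s => Finset.sum_nonneg fun i hi => (hf i hi).nonneg s,
    fun x y a b ha hb hab => ?_⟩
  rcases ha.eq_or_lt with rfl | ha'
  · obtain rfl : b = 1 := by linarith
    simp
  rcases hb.eq_or_lt with rfl | hb'
  · obtain rfl : a = 1 := by linarith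
    simp
  have hpq : (1 / a).HolderConjugate (1 / b) :=
    Real.holderConjugate_one_div ha' hb' hab
  calc ∑ i ∈ S, f i (a * x + b * y) ≤ ∑ i ∈ S, f i x ^ a * f i y ^ b :=
        Finset.sum_le_sum fun i hi => (hf i hi).2 x y a b ha hb hab
    _ ≤ (∑ i ∈ S, (f i x ^ a) ^ (1 / a)) ^ (1 / (1 / a)) *
          (∑ i ∈ S, (f i y ^ b) ^ (1 / b)) ^ (1 / (1 / b)) :=
        Real.inner_le_Lp_mul_Lq_of_nonneg S hpq
          (fun i hi => Real.rpow_nonneg ((hf i hi).nonneg _) _)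
          (fun i hi => Real.rpow_nonneg ((hf i hi).nonneg _) _)
    _ = (∑ i ∈ S, f i x) ^ a * (∑ i ∈ S, f i y) ^ b := by
        rw [one_div_one_div, one_div_one_div]
        congr 2
        · exact Finset.sum_congr rfl fun i hi => by
            rw [← Real.rpow_mul ((hf i hi).nonneg _), mul_one_div_cancel ha'.ne', Real.rpow_one]
        · exact Finset.sum_congr rfl fun i hi => by
            rw [← Real.rpow_mul ((hf i hi).nonneg _), mul_one_div_cancel hb'.ne', Real.rpow_one]

theorem const_mul_exp {c : ℝ} (hc : 0 ≤ c) (l : ℝ) :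
    LogConvex (fun s => c * Real.exp (s * l)) := by
  refine ⟨fun s => mul_nonneg hc (Real.exp_pos _).le, fun x y a b ha hb hab => le_of_eq ?_⟩
  -- Valid also for `c = 0`, because `a + b = 1` is nonzero; this covers vanishing coefficients.
  have e : c = c ^ a * c ^ b := by
    rw [← Real.rpow_add_of_nonneg hc ha hb, hab, Real.rpow_one]
  rw [Real.mul_rpow hc (Real.exp_pos _).le, Real.mul_rpow hc (Real.exp_pos _).le,
    ← Real.exp_mul, ← Real.exp_mul, mul_mul_mul_comm, ← e, ← Real.exp_add]
  congr 2
  ring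

/-- Weighted AM-GM: the geometric mean of the end values is at most the arithmetic mean. -/
theorem convexOn {f : ℝ → ℝ} (hf : LogConvex f) : ConvexOn ℝ Set.univ f := by
  refine ⟨convex_univ, fun x _ y _ a b ha hb hab => ?_⟩
  exact (hf.2 x y a b ha hb hab).trans
    (Real.geom_mean_le_arith_mean2_weighted ha hb (hf.nonneg _) (hf.nonneg _) hab)

theorem convexOn_log {f : ℝ → ℝ} (hf : LogConvex f) (hpos : ∀ s, 0 < f s) :
    ConvexOn ℝ Set.univ (fun s => Real.log (f s)) := by
  refine ⟨convex_univ, fun x _ y _ a b ha hb hab => ?_⟩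
  have h := Real.log_le_log (hpos _) (hf.2 x y a b ha hb hab)
  rwa [Real.log_mul (Real.rpow_pos_of_pos (hpos _) _).ne' (Real.rpow_pos_of_pos (hpos _) _).ne',
    Real.log_rpow (hpos _), Real.log_rpow (hpos _)] at h

/-- The three lines theorem for a vector-valued exponential polynomial whose norm only depends on
the real part. -/
theorem norm_exponential_sum {E κ : Type*} [NormedAddCommGroup E] [NormedSpace ℂ E] (S : Finset κ)
    (c : κ → ℂ) (x : κ → E)
    (h : ∀ s y : ℝ, ‖∑ k ∈ S, Complex.exp ((s + y * Complex.I) * c k) • x k‖ =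
      ‖∑ k ∈ S, Complex.exp (s * c k) • x k‖) :
    LogConvex (fun s : ℝ => ‖∑ k ∈ S, Complex.exp (s * c k) • x k‖) := by
  set F : ℂ → E := fun z => ∑ k ∈ S, Complex.exp (z * c k) • x k with hF
  have hre : ∀ z : ℂ, ‖F z‖ = ‖F z.re‖ := fun z => by
    have := h z.re z.im
    rwa [Complex.re_add_im] at this
  have hd : Differentiable ℂ F := by
    rw [hF]
    fun_prop
  refine ⟨fun s => norm_nonneg _, fun u v a b ha hb hab => ?_⟩
  change ‖F ((a * u + b * v : ℝ) : ℂ)‖ ≤ ‖F (u : ℂ)‖ ^ a * ‖F (v : ℂ)‖ ^ b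
  -- The map `w ↦ u + w (v - u)` carries the unit strip to the strip between `u` and `v`, with `w =
  -- b` going to `a u + b v`.
  have hline : ∀ w : ℂ, (u + w * (v - u) : ℂ).re = u + w.re * (v - u) := fun w => by simp
  have hdG : Differentiable ℂ (fun w : ℂ => F (u + w * (v - u))) := hd.comp (by fun_prop)
  have key := Complex.HadamardThreeLines.norm_le_interp_of_mem_verticalClosedStrip₀₁'
    (fun w : ℂ => F (u + w * (v - u))) (z := (b : ℂ)) (a := ‖F (u : ℂ)‖) (b := ‖F (v : ℂ)‖)
    (by
      simp only [Complex.HadamardThreeLines.verticalClosedStrip, Set.mem_preimage,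
        Complex.ofReal_re, Set.mem_Icc]
      exact ⟨hb, by linarith⟩)
    hdG.diffContOnCl
    (by
      -- Since the norm depends on the real part only, boundedness on the strip reduces to
      -- compactness of `[0, 1]`.
      have hc : ContinuousOn (fun r : ℝ => ‖F ((u + r * (v - u) : ℝ) : ℂ)‖) (Set.Icc 0 1) :=
        (hd.continuous.comp (by fun_prop)).norm.continuousOn
      refine (isCompact_Icc.image_of_continuousOn hc).bddAbove.mono ?_
      rintro _ ⟨w, hw, rfl⟩
      refine ⟨w.re, hw, ?_⟩
      simp only [Function.comp_apply]
      rw [hre (u + w * (v - u)), hline])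
    (fun w hw => by
      have hw' : w.re = 0 := hw
      rw [hre, hline, hw']
      simp)
    (fun w hw => by
      have hw' : w.re = 1 := hw
      rw [hre, hline, hw']
      simp)
  have e : ((a * u + b * v : ℝ) : ℂ) = u + b * (v - u) := by
    obtain rfl : a = 1 - b := by linarith
    push_cast
    ring
  rw [e]
  simpa only [Complex.ofReal_re, show 1 - b = a by linarith] using key

/-- `norm_exponential_sum` for a definite seminorm on a space without a topology. -/
theorem seminorm_exponential_sum {V κ : Type*} [AddCommGroup V] [Module ℂ V] (N : Seminorm ℂ V)
    (hN : ∀ A, N A = 0 → A = 0) (S : Finset κ) (c : κ → ℂ) (x : κ → V)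
    (h : ∀ s y : ℝ, N (∑ k ∈ S, Complex.exp ((s + y * Complex.I) * c k) • x k) =
      N (∑ k ∈ S, Complex.exp (s * c k) • x k)) :
    LogConvex (fun s : ℝ => N (∑ k ∈ S, Complex.exp (s * c k) • x k)) := by
  let : NormedAddCommGroup V := AddGroupNorm.toNormedAddCommGroup
    { N.toAddGroupSeminorm with eq_zero_of_map_eq_zero' := fun A hA => hN A hA }
  let : NormedSpace ℂ V := ⟨fun a v => (map_smul_eq_mul N a v).le⟩
  exact norm_exponential_sum S c x h

end LogConvex

/-! ### Effect of scaling and shuffling on coefficients, Jacobians and the Bombieri-Weyl norm. -/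

section Polynomial

variable {σ ι : Type*}

theorem scalePoly_add (t : σ → ℝ) (p q : MvPolynomial σ ℂ) :
    scalePoly t (p + q) = scalePoly t p + scalePoly t q := map_add _ _ _

theorem scalePoly_mul (t : σ → ℝ) (p q : MvPolynomial σ ℂ) :
    scalePoly t (p * q) = scalePoly t p * scalePoly t q := map_mul _ _ _

theorem scalePoly_C (t : σ → ℝ) (a : ℂ) : scalePoly t (MvPolynomial.C a) = MvPolynomial.C a := by
  simp [scalePoly]

theorem scalePoly_X (t : σ → ℝ) (j : σ) :
    scalePoly t (MvPolynomial.X j) = MvPolynomial.C (((t j)⁻¹ : ℝ) : ℂ) * MvPolynomial.X j := by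
  simp [scalePoly]

theorem coeff_scalePoly (t : σ → ℝ) (p : MvPolynomial σ ℂ) (α : σ →₀ ℕ) :
    (scalePoly t p).coeff α = p.coeff α * ((α.prod fun j k => ((t j)⁻¹) ^ k : ℝ) : ℂ) := by
  classical
  induction p using MvPolynomial.induction_on' with
  | monomial β a =>
    have h : scalePoly t (MvPolynomial.monomial β a) =
        MvPolynomial.monomial β (a * ((β.prod fun j k => ((t j)⁻¹) ^ k : ℝ) : ℂ)) := by
      rw [scalePoly, MvPolynomial.bind₁_monomial]
      simp only [mul_pow, Finset.prod_mul_distrib, Finsupp.prod, Complex.ofReal_prod,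
        Complex.ofReal_pow]
      rw [MvPolynomial.monomial_eq, map_mul, map_prod, mul_assoc]
      simp only [Finsupp.prod, map_pow, mul_comm]
    rw [h, MvPolynomial.coeff_monomial, MvPolynomial.coeff_monomial]
    split_ifs with hβ
    · rw [hβ]
    · simp
  | add p q hp hq => rw [scalePoly_add, MvPolynomial.coeff_add, hp, hq, MvPolynomial.coeff_add, add_mul]

theorem eval_scalePoly {t : σ → ℝ} (ht : ∀ j, t j ≠ 0) (p : MvPolynomial σ ℂ) (ξ : σ → ℂ) :
    MvPolynomial.eval (scalePoint t ξ) (scalePoly t p) = MvPolynomial.eval ξ p := by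
  induction p using MvPolynomial.induction_on with
  | C a => simp [scalePoly_C]
  | add p q hp hq => rw [scalePoly_add, map_add, hp, hq, map_add]
  | mul_X p j hp =>
    have h : (t j : ℂ) ≠ 0 := by exact_mod_cast ht j
    rw [scalePoly_mul, map_mul, hp, scalePoly_X, map_mul, map_mul]
    simp [scalePoint, h]

theorem pderiv_scalePoly (t : σ → ℝ) (p : MvPolynomial σ ℂ) (j : σ) :
    MvPolynomial.pderiv j (scalePoly t p) =
      MvPolynomial.C (((t j)⁻¹ : ℝ) : ℂ) * scalePoly t (MvPolynomial.pderiv j p) := by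
  classical
  induction p using MvPolynomial.induction_on with
  | C a => simp [scalePoly]
  | add p q hp hq => rw [scalePoly_add, map_add, hp, hq, map_add, scalePoly_add, mul_add]
  | mul_X p i hp =>
    rw [scalePoly_mul, MvPolynomial.pderiv_mul, MvPolynomial.pderiv_mul, hp, scalePoly_X,
      MvPolynomial.pderiv_C_mul, scalePoly_add, scalePoly_mul, scalePoly_mul, scalePoly_X]
    by_cases hij : i = j
    · subst hij
      simp only [MvPolynomial.pderiv_X_self]
      rw [show scalePoly t (1 : MvPolynomial σ ℂ) = 1 from map_one _]
      ring
    · rw [MvPolynomial.pderiv_X_of_ne hij, show scalePoly t (0 : MvPolynomial σ ℂ) = 0 from map_zero _]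
      ring

theorem jacobian_scale [Fintype σ] [DecidableEq σ] {t : σ → ℝ} (ht : ∀ j, t j ≠ 0)
    (f : ι → MvPolynomial σ ℂ) (ξ : σ → ℂ) :
    jacobian (scaleSystem t f) (scalePoint t ξ) =
      jacobian f ξ * Matrix.diagonal (fun j => (((t j)⁻¹ : ℝ) : ℂ)) := by
  ext i j
  rw [Matrix.mul_diagonal]
  simp only [jacobian, Matrix.of_apply, scaleSystem, pderiv_scalePoly, map_mul,
    MvPolynomial.eval_C, eval_scalePoly ht]
  ring

theorem jacobian_shuffle [Fintype ι] (X : Matrix ι ι ℂ) (f : ι → MvPolynomial σ ℂ) (ξ : σ → ℂ) :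
    jacobian (shuffle X f) ξ = X * jacobian f ξ := by
  ext i j
  simp [jacobian, shuffle, Matrix.mul_apply, MvPolynomial.smul_eval]

/-- The weight of the monomial `x^α` in the Bombieri-Weyl norm. -/
def bwWeight (α : σ →₀ ℕ) : ℝ := (α.prod fun _ k => (k ! : ℝ)) / (α.degree ! : ℝ)

theorem bwWeight_nonneg (α : σ →₀ ℕ) : 0 ≤ bwWeight α :=
  div_nonneg (Finset.prod_nonneg fun _ _ => Nat.cast_nonneg _) (Nat.cast_nonneg _)

/-- Allowing any `S` that contains the support makes the index set independent of the point on the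
geodesic. -/
theorem bwInner_self_re (f : MvPolynomial σ ℂ) {S : Finset (σ →₀ ℕ)} (hS : f.support ⊆ S) :
    (bwInner f f).re = ∑ α ∈ S, bwWeight α * ‖f.coeff α‖ ^ 2 := by
  rw [bwInner, Complex.re_sum]
  have : ∀ α ∈ S, α ∉ f.support → bwWeight α * ‖f.coeff α‖ ^ 2 = 0 := fun α _ h => by
    rw [MvPolynomial.notMem_support_iff.mp h]
    simp
  rw [← Finset.sum_subset hS this]
  refine Finset.sum_congr rfl fun α _ => ?_
  rw [Complex.re_ofReal_mul, Complex.mul_conj, Complex.ofReal_re, Complex.normSq_eq_norm_sq]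
  rfl

/-- Shows that the left side sees `X` only through its Gram matrix `Xᴴ * X`, which permits
exchanging `X` for any matrix with the same Gram matrix. -/
theorem sum_norm_sq_mulVec [Fintype ι] (X : Matrix ι ι ℂ) (c : ι → ℂ) :
    ∑ i, ‖(X *ᵥ c) i‖ ^ 2 = (star c ⬝ᵥ ((Xᴴ * X) *ᵥ c)).re := by
  rw [← Matrix.mulVec_mulVec, Matrix.dotProduct_mulVec, ← Matrix.star_mulVec, dotProduct,
    Complex.re_sum]
  refine Finset.sum_congr rfl fun i _ => ?_
  rw [Pi.star_apply, ← Complex.normSq_eq_norm_sq, ← Complex.ofReal_re (Complex.normSq _),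
    Complex.normSq_eq_conj_mul_self]
  rfl

theorem bwNorm_shuffle_scale [Fintype ι] (X : Matrix ι ι ℂ) (t : σ → ℝ) (f : ι → MvPolynomial σ ℂ)
    {S : Finset (σ →₀ ℕ)} (hS : ∀ i, (f i).support ⊆ S) :
    bwNorm (shuffle X (scaleSystem t f)) = Real.sqrt (∑ α ∈ S, ∑ i,
      bwWeight α * (α.prod fun j k => ((t j)⁻¹) ^ k) ^ 2 *
        ‖(X *ᵥ fun j => (f j).coeff α) i‖ ^ 2) := by
  have hc : ∀ i α, (shuffle X (scaleSystem t f) i).coeff α =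
      (X *ᵥ fun j => (f j).coeff α) i * ((α.prod fun j k => ((t j)⁻¹) ^ k : ℝ) : ℂ) := by
    intro i α
    simp only [shuffle, scaleSystem, MvPolynomial.coeff_sum, MvPolynomial.coeff_smul,
      coeff_scalePoly, Matrix.mulVec, dotProduct, Finset.sum_mul, smul_eq_mul, mul_assoc]
  have hsup : ∀ i, (shuffle X (scaleSystem t f) i).support ⊆ S := by
    intro i α hα
    by_contra h
    refine MvPolynomial.mem_support_iff.mp hα ?_
    have h0 : (fun j => (f j).coeff α) = 0 := funext fun j =>
      MvPolynomial.notMem_support_iff.mp fun h' => h (hS j h')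
    rw [hc, h0]
    simp
  rw [bwNorm, Finset.sum_comm]
  congr 1
  refine Finset.sum_congr rfl fun i _ => ?_
  rw [bwInner_self_re _ (hsup i)]
  refine Finset.sum_congr rfl fun α _ => ?_
  rw [hc, norm_mul, mul_pow, Complex.norm_real, Real.norm_eq_abs, sq_abs]
  ring

end Polynomial

/-! ### Inverses, one-parameter groups and unitarily invariant norms. -/

theorem pinv_eq_of_mul_eq_one {n : Type*} [Fintype n] [DecidableEq n] {A B : Matrix n n ℂ}
    (h : A * B = 1) : pinv A = B := by
  have h' : B * A = 1 := mul_eq_one_comm.mp h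
  refine (Classical.choose_spec (exists_isMoorePenrose A)).unique ⟨?_, ?_, ?_, ?_⟩
  · rw [h, one_mul]
  · rw [h', one_mul]
  · rw [h]; exact Matrix.isHermitian_one
  · rw [h']; exact Matrix.isHermitian_one

/-- Diagonalization of the one-parameter group `e^{sH}`. -/
theorem exists_exp_smul_eq {n : Type*} [Fintype n] [DecidableEq n] {H : Matrix n n ℂ}
    (hH : H.IsHermitian) : ∃ V ∈ Matrix.unitaryGroup n ℂ, ∃ l : n → ℝ, ∀ s : ℝ,
      NormedSpace.exp (s • H) = V * Matrix.diagonal (fun k => (Real.exp (s * l k) : ℂ)) * Vᴴ := by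
  refine ⟨(hH.eigenvectorUnitary : Matrix n n ℂ), hH.eigenvectorUnitary.2, hH.eigenvalues, fun s => ?_⟩
  set V : Matrix n n ℂ := (hH.eigenvectorUnitary : Matrix n n ℂ) with hV
  have hVV : V * Vᴴ = 1 := Matrix.mem_unitaryGroup_iff.mp hH.eigenvectorUnitary.2
  have hinv : V⁻¹ = Vᴴ := Matrix.inv_eq_right_inv hVV
  have hu : IsUnit V := IsUnit.of_mul_eq_one _ hVV
  have h1 : H = V * Matrix.diagonal (fun k => (hH.eigenvalues k : ℂ)) * V⁻¹ := by
    rw [hinv]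
    exact hH.spectral_theorem
  have h2 : s • H = V * Matrix.diagonal (fun k => ((s * hH.eigenvalues k : ℝ) : ℂ)) * V⁻¹ := by
    conv_lhs => rw [h1]
    rw [← Matrix.smul_mul, ← Matrix.mul_smul, ← Matrix.diagonal_smul]
    congr 3
    ext k
    simp
  rw [h2, Matrix.exp_conj _ _ hu, Matrix.exp_diagonal, hinv]
  congr 3
  ext k
  rw [Pi.coe_exp, Complex.ofReal_exp, Complex.exp_eq_exp_ℂ]

section UnitarilyInvariant

variable {m n : Type*} [Fintype m] [Fintype n] [DecidableEq m] [DecidableEq n]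

/-- Expansion in matrix units, which brings a two-sided diagonal action into the exponential-sum
form needed for the three lines theorem. -/
theorem sum_exp_smul_single (w : m → ℂ) (l : n → ℂ) (B : Matrix m n ℂ) (z : ℂ) :
    ∑ k : m × n, Complex.exp (z * (w k.1 + l k.2)) • Matrix.single k.1 k.2 (B k.1 k.2) =
      Matrix.diagonal (fun i => Complex.exp (z * w i)) * B *
        Matrix.diagonal (fun j => Complex.exp (z * l j)) := by
  ext i j
  rw [Matrix.mul_diagonal, Matrix.diagonal_mul, Matrix.sum_apply, Finset.sum_eq_single (i, j)]
  · rw [Matrix.smul_apply, Matrix.single_apply_same, mul_add, Complex.exp_add, smul_eq_mul]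
    ring
  · rintro ⟨a, b⟩ - hab
    rw [Matrix.smul_apply, Matrix.single_apply_of_ne, smul_zero]
    rintro ⟨rfl, rfl⟩
    exact hab rfl
  · simp

theorem diagonal_exp_mul_I_mem_unitaryGroup (w : m → ℝ) (y : ℝ) :
    Matrix.diagonal (fun i => Complex.exp (y * Complex.I * w i)) ∈ Matrix.unitaryGroup m ℂ := by
  rw [Matrix.mem_unitaryGroup_iff', Matrix.star_eq_conjTranspose, Matrix.diagonal_conjTranspose,
    Matrix.diagonal_mul_diagonal, ← Matrix.diagonal_one]
  congr 1
  ext i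
  rw [Pi.star_apply, RCLike.star_def, ← Complex.exp_conj, ← Complex.exp_add]
  simp

/-- The imaginary part of the complexified parameter contributes only unitary diagonal factors on
either side; `N` ignores them, and the three lines theorem applies. -/
theorem IsUnitarilyInvariantNorm.logConvex {N : Seminorm ℂ (Matrix m n ℂ)}
    (hN : IsUnitarilyInvariantNorm N) (w : m → ℝ) (l : n → ℝ) (B : Matrix m n ℂ) :
    LogConvex (fun s : ℝ => N (Matrix.diagonal (fun i => (Real.exp (s * w i) : ℂ)) * B *
      Matrix.diagonal (fun j => (Real.exp (s * l j) : ℂ)))) := by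
  have key := LogConvex.seminorm_exponential_sum N hN.eq_zero Finset.univ
    (fun k : m × n => (w k.1 : ℂ) + (l k.2 : ℂ))
    (fun k => Matrix.single k.1 k.2 (B k.1 k.2)) (fun s y => by
      rw [sum_exp_smul_single (fun i => (w i : ℂ)) (fun j => (l j : ℂ)),
        sum_exp_smul_single (fun i => (w i : ℂ)) (fun j => (l j : ℂ))]
      rw [← hN.unitary_mul_mul _ (diagonal_exp_mul_I_mem_unitaryGroup w y) _
        (diagonal_exp_mul_I_mem_unitaryGroup l y)
        (Matrix.diagonal (fun i => Complex.exp (s * w i)) * B * _)]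
      congr 1
      ext i j
      simp only [Matrix.mul_diagonal, Matrix.diagonal_mul, add_mul, Complex.exp_add]
      ring)
  simp only [sum_exp_smul_single (fun i => (w i : ℂ)) (fun j => (l j : ℂ))] at key
  simpa only [Complex.ofReal_exp, Complex.ofReal_mul] using key

end UnitarilyInvariant

/-! ### Log-convexity of the condition number along geodesics. -/

theorem prod_inv_exp_mul_pow {σ : Type*} (w r : σ → ℝ) (s : ℝ) (α : σ →₀ ℕ) :
    (α.prod fun j k => ((Real.exp (s * w j) * r j)⁻¹) ^ k) =
      Real.exp (s * -(α.sum fun j k => k * w j)) * α.prod fun j k => ((r j)⁻¹) ^ k := by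
  simp only [Finsupp.prod, Finsupp.sum]
  rw [← Finset.sum_neg_distrib, Finset.mul_sum, Real.exp_sum, ← Finset.prod_mul_distrib]
  refine Finset.prod_congr rfl fun j _ => ?_
  rw [mul_inv, mul_pow, ← Real.exp_neg, ← Real.exp_nat_mul]
  congr 2
  ring

section Geodesic

variable {σ ι : Type*} [Fintype ι] [DecidableEq ι]

/-- Passing from `X s` to the diagonal exponential times `A` through `hX` decouples the rows: each
pair of a monomial and a row contributes a nonnegative constant times one exponential in `s`. -/
theorem logConvex_bwNorm (p : ι → MvPolynomial σ ℂ) (w r : σ → ℝ) (l : ι → ℝ) (A : Matrix ι ι ℂ)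
    (X : ℝ → Matrix ι ι ℂ)
    (hX : ∀ s, (X s)ᴴ * X s = (Matrix.diagonal (fun k => (Real.exp (s * l k) : ℂ)) * A)ᴴ *
      (Matrix.diagonal (fun k => (Real.exp (s * l k) : ℂ)) * A)) :
    LogConvex (fun s => bwNorm (shuffle (X s)
      (scaleSystem (fun j => Real.exp (s * w j) * r j) p))) := by
  classical
  -- Shuffling mixes the members of the system, so the union of all supports is needed.
  set S : Finset (σ →₀ ℕ) := Finset.univ.biUnion fun i => (p i).support with hS
  have hsub : ∀ i, (p i).support ⊆ S := fun i => Finset.subset_biUnion_of_mem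
    (fun i => (p i).support) (Finset.mem_univ i)
  have e : ∀ s, bwNorm (shuffle (X s) (scaleSystem (fun j => Real.exp (s * w j) * r j) p)) =
      Real.sqrt (∑ α ∈ S, ∑ i, bwWeight α * (α.prod fun j k => ((r j)⁻¹) ^ k) ^ 2 *
        ‖(A *ᵥ fun j => (p j).coeff α) i‖ ^ 2 *
          Real.exp (s * (2 * (l i - α.sum fun j k => k * w j)))) := by
    intro s
    rw [bwNorm_shuffle_scale _ _ _ hsub]
    congr 1
    refine Finset.sum_congr rfl fun α _ => ?_
    rw [← Finset.mul_sum, sum_norm_sq_mulVec, hX, ← sum_norm_sq_mulVec, Finset.mul_sum]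
    refine Finset.sum_congr rfl fun i _ => ?_
    rw [← Matrix.mulVec_mulVec, Matrix.mulVec_diagonal, norm_mul, Complex.norm_real,
      Real.norm_eq_abs, Real.abs_exp, prod_inv_exp_mul_pow, mul_pow, mul_pow,
      show s * (2 * (l i - α.sum fun j k => k * w j)) =
        ((2 : ℕ) : ℝ) * (s * -(α.sum fun j k => k * w j)) + ((2 : ℕ) : ℝ) * (s * l i) by
          push_cast; ring,
      Real.exp_add, Real.exp_nat_mul, Real.exp_nat_mul]
    ring
  simp only [e]
  refine LogConvex.sqrt (LogConvex.sum _ fun α _ => LogConvex.sum _ fun i _ =>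
    LogConvex.const_mul_exp ?_ _)
  exact mul_nonneg (mul_nonneg (bwWeight_nonneg α) (sq_nonneg _)) (sq_nonneg _)

theorem logConvex_localCond {p : ι → MvPolynomial ι ℂ} {ξ : ι → ℂ}
    (hJ : (jacobian p ξ).det ≠ 0) {N : Seminorm ℂ (Matrix ι ι ℂ)}
    (hN : IsUnitarilyInvariantNorm N) (w : ι → ℝ) {r : ι → ℝ} (hr : ∀ j, r j ≠ 0) (l : ι → ℝ)
    {A : Matrix ι ι ℂ} (hA : A.det ≠ 0) (X : ℝ → Matrix ι ι ℂ)
    (hX : ∀ s, (X s)ᴴ * X s = (Matrix.diagonal (fun k => (Real.exp (s * l k) : ℂ)) * A)ᴴ *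
      (Matrix.diagonal (fun k => (Real.exp (s * l k) : ℂ)) * A)) :
    LogConvex (fun s => localCond N (shuffle (X s)
      (scaleSystem (fun j => Real.exp (s * w j) * r j) p))
        (scalePoint (fun j => Real.exp (s * w j) * r j) ξ)) := by
  refine (logConvex_bwNorm p w r l A X hX).mul ?_
  have key := hN.logConvex w (fun k => -l k)
    (Matrix.diagonal (fun i => (r i : ℂ)) * (jacobian p ξ)⁻¹ * A⁻¹)
  convert key using 2 with s
  set u : ι → ℝ := fun j => Real.exp (s * w j) * r j with hu
  have hu0 : ∀ j, u j ≠ 0 := fun j => mul_ne_zero (Real.exp_pos _).ne' (hr j)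
  set D : Matrix ι ι ℂ := Matrix.diagonal (fun k => (Real.exp (s * l k) : ℂ)) with hD
  set D' : Matrix ι ι ℂ := Matrix.diagonal (fun k => (Real.exp (s * -l k) : ℂ)) with hD'
  have hDD : D' * D = 1 := by
    rw [hD, hD', Matrix.diagonal_mul_diagonal, ← Matrix.diagonal_one]
    congr 1
    ext k
    rw [← Complex.ofReal_mul, ← Real.exp_add]
    simp
  have hDA : IsUnit (D * A).det := by
    rw [Matrix.det_mul]
    exact (IsUnit.of_mul_eq_one_right D'.det (by rw [← Matrix.det_mul, hDD, Matrix.det_one])).mul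
      hA.isUnit
  have hXu : IsUnit (X s).det := by
    have h : IsUnit ((X s)ᴴ * X s).det := by
      rw [hX s, Matrix.det_mul, Matrix.det_conjTranspose]
      exact hDA.star.mul hDA
    rw [Matrix.det_mul] at h
    exact isUnit_of_mul_isUnit_right h
  -- Equal Gram matrices of two invertible matrices mean that they differ by a left unitary factor;
  -- `W` is that factor, and `(X s)⁻¹ = A⁻¹ * D' * W`.
  set W : Matrix ι ι ℂ := D * A * (X s)⁻¹ with hW
  have hWu : W ∈ Matrix.unitaryGroup ι ℂ := by
    rw [Matrix.mem_unitaryGroup_iff', Matrix.star_eq_conjTranspose, hW,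
      Matrix.conjTranspose_mul, Matrix.mul_assoc, ← Matrix.mul_assoc _ _ (X s)⁻¹, ← hX s,
      Matrix.mul_assoc (X s)ᴴ, Matrix.mul_nonsing_inv _ hXu, Matrix.mul_one,
      ← Matrix.conjTranspose_mul, Matrix.mul_nonsing_inv _ hXu, Matrix.conjTranspose_one]
  have huu : Matrix.diagonal (fun j => (((u j)⁻¹ : ℝ) : ℂ)) *
      Matrix.diagonal (fun j => (u j : ℂ)) = 1 := by
    rw [Matrix.diagonal_mul_diagonal, ← Matrix.diagonal_one]
    congr 1
    ext k
    rw [← Complex.ofReal_mul, inv_mul_cancel₀ (hu0 k), Complex.ofReal_one]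
  rw [jacobian_shuffle, jacobian_scale hu0,
    pinv_eq_of_mul_eq_one (B := Matrix.diagonal (fun j => (u j : ℂ)) * (jacobian p ξ)⁻¹ * A⁻¹ *
      D' * W)]
  -- Unitary invariance absorbs `W` on the right, leaving a constant matrix between two diagonal
  -- exponentials.
  · rw [← hN.unitary_mul_mul 1 (one_mem _) W hWu (_ * _ * D'), Matrix.one_mul]
    congr 3
    rw [← Matrix.mul_assoc, ← Matrix.mul_assoc, Matrix.diagonal_mul_diagonal]
    simp only [hu, Complex.ofReal_mul]
  · have hJu : IsUnit (jacobian p ξ).det := hJ.isUnit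
    calc X s * (jacobian p ξ * Matrix.diagonal (fun j => (((u j)⁻¹ : ℝ) : ℂ))) *
          (Matrix.diagonal (fun j => (u j : ℂ)) * (jacobian p ξ)⁻¹ * A⁻¹ * D' * W)
        = X s * jacobian p ξ * (Matrix.diagonal (fun j => (((u j)⁻¹ : ℝ) : ℂ)) *
          Matrix.diagonal (fun j => (u j : ℂ))) * (jacobian p ξ)⁻¹ * A⁻¹ * (D' * D) * A *
            (X s)⁻¹ := by simp only [hW, Matrix.mul_assoc]
      _ = X s * (jacobian p ξ * (jacobian p ξ)⁻¹) * (A⁻¹ * A) * (X s)⁻¹ := by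
        rw [huu, hDD]
        simp only [Matrix.mul_one, Matrix.mul_assoc]
      _ = 1 := by
        rw [Matrix.mul_nonsing_inv _ hJu, Matrix.nonsing_inv_mul _ hA.isUnit, Matrix.mul_one,
          Matrix.mul_one, Matrix.mul_nonsing_inv _ hXu]

end Geodesic

theorem cosetRep_expPair_snd {n : ℕ} (g : PreGroup n) (H : Matrix (Fin n) (Fin n) ℂ)
    (v : Fin n → ℝ) (i : Fin n) :
    (cosetRep (expPair H v * g)).2.1 i = Real.exp (v i) * ‖(g.2 i : ℂ)‖ := by
  simp only [cosetRep, expPair, Prod.snd_mul, Pi.mul_apply, Units.val_mul, Units.val_mk0, norm_mul,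
    Complex.norm_real, Real.norm_eq_abs, Real.abs_exp]

/-- With `e^{sH} = V D_s Vᴴ`, the outer `V` cancels in the Gram matrix of `e^{sH} g`, so `A = Vᴴ g`
works for all `s` at once. -/
theorem exists_cosetRep_expPair_fst {n : ℕ} (g : PreGroup n) {H : Matrix (Fin n) (Fin n) ℂ}
    (hH : H.IsHermitian) (v : Fin n → ℝ) :
    ∃ (l : Fin n → ℝ) (A : Matrix (Fin n) (Fin n) ℂ), A.det ≠ 0 ∧ ∀ s : ℝ,
      (cosetRep (expPair (s • H) (s • v) * g)).1.1ᴴ * (cosetRep (expPair (s • H) (s • v) * g)).1.1 =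
        (Matrix.diagonal (fun k => (Real.exp (s * l k) : ℂ)) * A)ᴴ *
          (Matrix.diagonal (fun k => (Real.exp (s * l k) : ℂ)) * A) := by
  obtain ⟨V, hV, l, hl⟩ := exists_exp_smul_eq hH
  have hVV : Vᴴ * V = 1 := Matrix.mem_unitaryGroup_iff'.mp hV
  refine ⟨l, Vᴴ * (g.1 : Matrix (Fin n) (Fin n) ℂ), ?_, fun s => ?_⟩
  · rw [Matrix.det_mul]
    refine mul_ne_zero ?_ ((Matrix.isUnit_iff_isUnit_det _).mp g.1.isUnit).ne_zero
    intro h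
    have := congrArg Matrix.det hVV
    rw [Matrix.det_mul, h, zero_mul, Matrix.det_one] at this
    exact zero_ne_one this
  · rw [(cosetRep (expPair (s • H) (s • v) * g)).1.2.isHermitian]
    simp only [cosetRep]
    rw [CFC.sqrt_mul_sqrt_self _ (posDef_gram _).posSemidef.nonneg]
    simp only [expPair, Prod.fst_mul, Units.val_mul, IsUnit.unit_spec, hl]
    set D := Matrix.diagonal (fun k => (Real.exp (s * l k) : ℂ))
    simp only [Matrix.conjTranspose_mul, Matrix.mul_assoc, Matrix.conjTranspose_conjTranspose]
    rw [← Matrix.mul_assoc Vᴴ V, hVV, Matrix.one_mul]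

/-! ### Convexity and minimizers of `h_ξ`. -/

theorem logConvex_sum_monomials {n : ℕ} (c τ v : Fin n → ℝ) (hc : ∀ j, 0 < c j)
    (hτ : ∀ j, 0 < τ j) (a b : Fin n → Fin n → ℤ) :
    LogConvex (fun s => ∑ i, (∏ j, c j ^ a i j) * ∏ j, (Real.exp (s * v j) * τ j) ^ b i j) := by
  have e : ∀ s, ∑ i, (∏ j, c j ^ a i j) * ∏ j, (Real.exp (s * v j) * τ j) ^ b i j =
      ∑ i, ((∏ j, c j ^ a i j) * ∏ j, τ j ^ b i j) * Real.exp (s * ∑ j, b i j * v j) := by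
    intro s
    refine Finset.sum_congr rfl fun i _ => ?_
    have h : ∏ j, (Real.exp (s * v j) * τ j) ^ b i j =
        (∏ j, τ j ^ b i j) * ∏ j, Real.exp (s * (b i j * v j)) := by
      rw [← Finset.prod_mul_distrib]
      refine Finset.prod_congr rfl fun j _ => ?_
      rw [mul_zpow, ← Real.rpow_intCast, ← Real.exp_mul, mul_comm, mul_assoc, mul_comm (v j)]
    rw [Finset.mul_sum, Real.exp_sum, mul_assoc, h]
  simp only [e]
  refine LogConvex.sum _ fun i _ => LogConvex.const_mul_exp ?_ _
  exact mul_nonneg (Finset.prod_nonneg fun j _ => (zpow_pos (hc j) _).le)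
    (Finset.prod_nonneg fun j _ => (zpow_pos (hτ j) _).le)

theorem geodesicallyConvex_hFun {n : ℕ} {ξ : Fin n → ℂ} (hξ : ∀ i, ξ i ≠ 0) :
    GeodesicallyConvex (fun q : PD n × PosVec n => hFun ξ q.2.1) := by
  intro g H v _
  have e : ∀ s : ℝ, hFun ξ (cosetRep (expPair (s • H) (s • v) * g)).2.1 = Real.log (∑ i,
      (∏ j, ‖ξ j‖ ^ omega n i j) *
        ∏ j, (Real.exp (s * v j) * ‖(g.2 j : ℂ)‖) ^ (-omega n i j)) := by
    intro s
    simp only [hFun, cosetRep_expPair_snd, Pi.smul_apply, smul_eq_mul]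
  simp only [e]
  -- For `n = 0` the sum is empty and `Real.log 0 = 0`, so the function is constant; otherwise the
  -- sum is positive.
  rcases Nat.eq_zero_or_pos n with rfl | hn
  · simpa using convexOn_const (0 : ℝ) (convex_univ (𝕜 := ℝ) (E := ℝ))
  have : Nonempty (Fin n) := ⟨⟨0, hn⟩⟩
  have hg : ∀ j, 0 < ‖(g.2 j : ℂ)‖ := fun j => norm_pos_iff.mpr (g.2 j).ne_zero
  have hξ' : ∀ j, 0 < ‖ξ j‖ := fun j => norm_pos_iff.mpr (hξ j)
  refine (logConvex_sum_monomials _ _ v hξ' hg _ _).convexOn_log fun s => ?_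
  exact Finset.sum_pos (fun i _ => mul_pos (Finset.prod_pos fun j _ => zpow_pos (hξ' j) _)
    (Finset.prod_pos fun j _ => zpow_pos (mul_pos (Real.exp_pos _) (hg j)) _))
    Finset.univ_nonempty

theorem hFun_eq {n : ℕ} (ξ : Fin n → ℂ) {t : Fin n → ℝ} (hξ : ∀ i, ξ i ≠ 0) (ht : ∀ i, 0 < t i) :
    hFun ξ t = Real.log ((∑ i, (‖ξ i‖ * (t i)⁻¹) ^ n) / ∏ j, ‖ξ j‖ * (t j)⁻¹) := by
  rw [hFun, Finset.sum_div]
  congr 1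
  refine Finset.sum_congr rfl fun i _ => ?_
  have hr : ∀ j, ‖ξ j‖ * (t j)⁻¹ ≠ 0 := fun j =>
    mul_ne_zero (norm_ne_zero_iff.mpr (hξ j)) (inv_ne_zero (ht j).ne')
  rw [← Finset.prod_mul_distrib]
  calc ∏ j, ‖ξ j‖ ^ omega n i j * t j ^ (-omega n i j)
      = ∏ j, (‖ξ j‖ * (t j)⁻¹) ^ ((n : ℤ) * (Pi.single i 1 : Fin n → ℤ) j) /
          (‖ξ j‖ * (t j)⁻¹) := by
        refine Finset.prod_congr rfl fun j _ => ?_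
        rw [zpow_neg, ← inv_zpow, ← mul_zpow, omega, zpow_sub_one₀ (hr j), div_eq_mul_inv]
    _ = (‖ξ i‖ * (t i)⁻¹) ^ n / ∏ j, ‖ξ j‖ * (t j)⁻¹ := by
        rw [Finset.prod_div_distrib, Finset.prod_eq_single i]
        · simp
        · intro j _ hj
          simp [hj]
        · simp

/-- AM-GM for the numbers `r i ^ n` with equal weights `1 / n`, together with its equality case;
`n`-th powers are injective on positive reals. -/
theorem card_mul_prod_le_sum_pow {n : ℕ} {r : Fin n → ℝ} (hr : ∀ i, 0 < r i) :
    n * ∏ i, r i ≤ ∑ i, r i ^ n ∧ (n * ∏ i, r i = ∑ i, r i ^ n ↔ ∀ i j, r i = r j) := by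
  rcases Nat.eq_zero_or_pos n with rfl | hn
  · simp
  have hn' : (0 : ℝ) < n := by exact_mod_cast hn
  have hw : ∑ _i : Fin n, (n : ℝ)⁻¹ = 1 := by simp [hn'.ne']
  have hprod : ∏ i, (r i ^ n) ^ (n : ℝ)⁻¹ = ∏ i, r i :=
    Finset.prod_congr rfl fun i _ => Real.pow_rpow_inv_natCast (hr i).le hn.ne'
  have hle := Real.geom_mean_le_arith_mean_weighted Finset.univ (fun _ : Fin n => (n : ℝ)⁻¹)
    (fun i => r i ^ n) (fun _ _ => (inv_pos.mpr hn').le) hw (fun i _ => (pow_pos (hr i) n).le)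
  have hiff := Real.geom_mean_eq_arith_mean_weighted_iff_of_pos Finset.univ
    (fun _ : Fin n => (n : ℝ)⁻¹) (fun i => r i ^ n) (fun _ _ => inv_pos.mpr hn') hw
    (fun i _ => (pow_pos (hr i) n).le)
  rw [hprod, ← Finset.mul_sum] at hle hiff
  refine ⟨by rwa [le_inv_mul_iff₀ hn'] at hle, ?_⟩
  rw [eq_inv_mul_iff_mul_eq₀ hn'.ne'] at hiff
  rw [hiff]
  simp only [Finset.mem_univ, forall_const]
  exact forall₂_congr fun i j => pow_left_inj₀ (hr i).le (hr j).le hn.ne'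

theorem hFun_minimal_iff {n : ℕ} {ξ : Fin n → ℂ} (hξ : ∀ i, ξ i ≠ 0) (t : PosVec n) :
    (∀ t' : PosVec n, hFun ξ t.1 ≤ hFun ξ t'.1) ↔
      ∀ i j, ‖ξ i‖ * (t.1 i)⁻¹ = ‖ξ j‖ * (t.1 j)⁻¹ := by
  rcases Nat.eq_zero_or_pos n with rfl | hn
  · simp [hFun]
  have hn' : (0 : ℝ) < n := by exact_mod_cast hn
  have hr : ∀ (t : PosVec n) i, 0 < ‖ξ i‖ * (t.1 i)⁻¹ := fun t i =>
    mul_pos (norm_pos_iff.mpr (hξ i)) (inv_pos.mpr (t.2 i))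
  have hP : ∀ t : PosVec n, 0 < ∏ i, ‖ξ i‖ * (t.1 i)⁻¹ := fun t =>
    Finset.prod_pos fun i _ => hr t i
  have hge : ∀ t : PosVec n, Real.log n ≤ hFun ξ t.1 := fun t => by
    rw [hFun_eq ξ hξ t.2]
    exact Real.log_le_log hn' ((le_div_iff₀ (hP t)).mpr (card_mul_prod_le_sum_pow (hr t)).1)
  have heq : ∀ t : PosVec n, hFun ξ t.1 = Real.log n ↔
      ∀ i j, ‖ξ i‖ * (t.1 i)⁻¹ = ‖ξ j‖ * (t.1 j)⁻¹ := fun t => by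
    have hpos : 0 < (∑ i, (‖ξ i‖ * (t.1 i)⁻¹) ^ n) / ∏ j, ‖ξ j‖ * (t.1 j)⁻¹ :=
      hn'.trans_le ((le_div_iff₀ (hP t)).mpr (card_mul_prod_le_sum_pow (hr t)).1)
    rw [← (card_mul_prod_le_sum_pow (hr t)).2, hFun_eq ξ hξ t.2,
      Real.log_injOn_pos.eq_iff hpos hn', div_eq_iff (hP t).ne', eq_comm]
  rw [← heq]
  refine ⟨fun h => le_antisymm ?_ (hge t), fun h t' => h.le.trans (hge t')⟩
  -- At `t = |ξ|` all ratios equal 1, so the lower bound `log n` is attained and every minimizer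
  -- must attain it.
  let t₀ : PosVec n := ⟨fun i => ‖ξ i‖, fun i => norm_pos_iff.mpr (hξ i)⟩
  refine (h t₀).trans_eq ((heq t₀).mpr fun i j => ?_)
  rw [mul_inv_cancel₀ (norm_ne_zero_iff.mpr (hξ i)), mul_inv_cancel₀ (norm_ne_zero_iff.mpr (hξ j))]

end Precond

end

theorem mainTheorem9 (n : ℕ) (p : Fin n → MvPolynomial (Fin n) ℂ) (ξ : Fin n → ℂ)
    (hξ : ∀ i, ξ i ≠ 0) (hJ : (Precond.jacobian p ξ).det ≠ 0)
    (N : Seminorm ℂ (Matrix (Fin n) (Fin n) ℂ)) (hN : Precond.IsUnitarilyInvariantNorm N) :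
    Precond.GeodesicallyConvex (fun q : Precond.PD n × Precond.PosVec n =>
      Precond.localCond N
        (Precond.shuffle q.1.1 (Precond.scaleSystem q.2.1⁻¹ p)) (Precond.scalePoint q.2.1⁻¹ ξ)
      + Precond.hFun ξ q.2.1) ∧
    Precond.GeodesicallyConvex (fun q : Precond.PD n × Precond.PosVec n =>
      Precond.localCond N
        (Precond.shuffle q.1.1 (Precond.scaleSystem q.2.1 p)) (Precond.scalePoint q.2.1 ξ)
      + Precond.hFun ξ q.2.1) ∧
    Precond.GeodesicallyConvex (fun q : Precond.PD n × Precond.PosVec n =>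
      Precond.hFun ξ q.2.1) ∧
    ∀ t : Precond.PosVec n,
      (∀ t' : Precond.PosVec n, Precond.hFun ξ t.1 ≤ Precond.hFun ξ t'.1) ↔
        ∀ i j, ‖ξ i‖ * (t.1 i)⁻¹ = ‖ξ j‖ * (t.1 j)⁻¹ := by
  have hh := Precond.geodesicallyConvex_hFun hξ
  refine ⟨fun g H v hH => (ConvexOn.add ?_ (hh g H v hH)), fun g H v hH =>
    (ConvexOn.add ?_ (hh g H v hH)), hh, Precond.hFun_minimal_iff hξ⟩
  · obtain ⟨l, A, hA, hX⟩ := Precond.exists_cosetRep_expPair_fst g hH v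
    -- Inverting `t` turns the path `e^{sv} |τ|` into `e^{-sv} |τ|⁻¹`, which has the same form with
    -- velocity `-v`.
    have key := (Precond.logConvex_localCond hJ hN (fun j => -v j)
      (r := fun j => ‖(g.2 j : ℂ)‖⁻¹) (fun j => inv_ne_zero (norm_ne_zero_iff.mpr (g.2 j).ne_zero))
      l hA _ hX).convexOn
    have e : ∀ s : ℝ, (Precond.cosetRep (Precond.expPair (s • H) (s • v) * g)).2.1⁻¹ =
        fun j => Real.exp (s * -v j) * ‖(g.2 j : ℂ)‖⁻¹ := fun s => by
      ext j
      rw [Pi.inv_apply, Precond.cosetRep_expPair_snd, mul_inv, ← Real.exp_neg, Pi.smul_apply,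
        smul_eq_mul, mul_neg]
    simpa only [e] using key
  · obtain ⟨l, A, hA, hX⟩ := Precond.exists_cosetRep_expPair_fst g hH v
    have key := (Precond.logConvex_localCond hJ hN v
      (r := fun j => ‖(g.2 j : ℂ)‖) (fun j => norm_ne_zero_iff.mpr (g.2 j).ne_zero)
      l hA _ hX).convexOn
    have e : ∀ s : ℝ, (Precond.cosetRep (Precond.expPair (s • H) (s • v) * g)).2.1 =
        fun j => Real.exp (s * v j) * ‖(g.2 j : ℂ)‖ := fun s => by
      ext j
      rw [Precond.cosetRep_expPair_snd, Pi.smul_apply, smul_eq_mul]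
    simpa only [e] using key
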